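/- Let $H^1$ be the Sobolev space of real functions $u\in L^2(\mathbb R)$ with weak derivative $u'\in L^2(\mathbb R)$, let $G(x,y)=\tfrac12(|x|+|y|-|x-y|)$ (which is $\min\{|x|,|y|\}$ if $xy>0$ and $0$ otherwise), and put $$\mathcal X_1=\Big\{u\in H^1:\ \int_{\mathbb R}|x|\,u(x)^2\,dx<\infty,\ \|u\|_2=1\Big\},\qquad \mathcal B_1=\Big\{u\in H^1:\ \iint_{\mathbb R^2} G(x,y)\,u(x)^2u(y)^2\,dx\,dy<\infty,\ \|u\|_2=1\Big\}.$$ For a point charge of strength $z$ at the origin, let the energy be $$E[u]=\int_{\mathbb R}|u'(x)|^2\,dx+\frac12\iint_{\mathbb R^2}\big[z(|x|+|y|)-|x-y|\big]\,u(x)^2\,u(y)^2\,dx\,dy$$ (for $u\in\mathcal X_1$ this equals $\int|u'|^2-\frac12\iint|x-y|\,u(x)^2u(y)^2\,dx\,dy+z\int|x|\,u(x)^2\,dx$). Let $u$ be a minimiser of $E$ in $\mathcal X_1$ if $z>1$, or in $\mathcal B_1$ if $z=1$. Then, up to a global sign, $u$ is symmetric nonincreasing: there is a continuous function $v\ge 0$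 which is even and nonincreasing on $[0,\infty)$ such that $u=v$ almost everywhere or $u=-v$ almost everywhere. -/

import Mathlib

open MeasureTheory Filter Set
open scoped ContDiff

namespace HydrogenLikeAtom

/-- `g` is a weak derivative of `u` on the real line. -/
def IsWeakDeriv (u g : ℝ → ℝ) : Prop :=
  LocallyIntegrable u ∧ LocallyIntegrable g ∧
    ∀ φ : ℝ → ℝ, ContDiff ℝ ∞ φ → HasCompactSupport φ →
      ∫ x, u x * deriv φ x = -∫ x, g x * φ x

/-- The Sobolev space `H¹(ℝ)` of real functions (not identified up to null sets): `u` is square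
integrable and has a square integrable weak derivative. -/
def H1 : Set (ℝ → ℝ) :=
  {u | MemLp u 2 ∧ ∃ g, MemLp g 2 ∧ IsWeakDeriv u g}

open Classical in
/-- The weak derivative `u'` of `u ∈ H¹(ℝ)`, which is unique up to null sets
(and the zero function if `u ∉ H¹(ℝ)`). -/
noncomputable def weakDeriv (u : ℝ → ℝ) : ℝ → ℝ :=
  if h : ∃ g, MemLp g 2 ∧ IsWeakDeriv u g then h.choose else 0

/-- The kernel `G(x, y) = (|x| + |y| - |x - y|) / 2`, which is `min (|x|, |y|)` if `x y > 0` and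
`0` otherwise. -/
noncomputable def G (x y : ℝ) : ℝ := (|x| + |y| - |x - y|) / 2

/-- The space `𝓧` of all `u ∈ H¹` with `∫ |x| u(x)² dx < ∞`. -/
def spaceX : Set (ℝ → ℝ) :=
  {u | u ∈ H1 ∧ Integrable fun x => |x| * u x ^ 2}

/-- The space `𝓑` of all `u ∈ H¹` with `∬ G(x, y) u(x)² u(y)² dx dy < ∞`
(the integrand is nonnegative). -/
def spaceB : Set (ℝ → ℝ) :=
  {u | u ∈ H1 ∧ Integrable fun p : ℝ × ℝ => G p.1 p.2 * u p.1 ^ 2 * u p.2 ^ 2}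

/-- `A₁`: the elements of `A` with `‖u‖₂ = 1`. -/
def normalized (A : Set (ℝ → ℝ)) : Set (ℝ → ℝ) :=
  {u | u ∈ A ∧ ∫ x, u x ^ 2 = 1}

/-- The potential energy `C[f] = ½ ∬ [z (|x| + |y|) - |x - y|] f(x) f(y) dx dy` in the field of a
point charge of strength `z` at the origin. -/
noncomputable def potentialEnergy (z : ℝ) (f : ℝ → ℝ) : ℝ :=
  1 / 2 * ∫ p : ℝ × ℝ, (z * (|p.1| + |p.2|) - |p.1 - p.2|) * f p.1 * f p.2

/-- The energy `E[u] = ‖u'‖₂² + C[u²]` for the background `-z δ₀`. In this form, unlike in the one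
with the three separate terms (see `energy_eq`), it makes sense on all of `𝓑₁` when `z = 1`. -/
noncomputable def energy (z : ℝ) (u : ℝ → ℝ) : ℝ :=
  (∫ x, weakDeriv u x ^ 2) + potentialEnergy z fun x => u x ^ 2

/-- A function on the line which is even and nonincreasing in `|x|`. -/
def IsSymmNonincreasing (v : ℝ → ℝ) : Prop :=
  (∀ x, v (-x) = v x) ∧ AntitoneOn v (Ici 0)

/-- The kernel `G` is the one of the Coulomb problem on each half-line. -/
theorem G_eq (x y : ℝ) : G x y = if 0 < x * y then min |x| |y| else 0 := by
  unfold G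
  split_ifs with h
  · rcases mul_pos_iff.mp h with ⟨hx, hy⟩ | ⟨hx, hy⟩ <;> rcases le_total x y with hxy | hxy <;>
      grind
  · have hxy : (0 ≤ x ∧ y ≤ 0) ∨ (x ≤ 0 ∧ 0 ≤ y) := mul_nonpos_iff.mp (not_lt.mp h)
    grind

/-- On `𝓧₁` the energy is
`‖u'‖₂² - ½ ∬ |x - y| u(x)² u(y)² dx dy + z ∫ |x| u(x)² dx`, with all integrals absolutely
convergent. -/
theorem energy_eq (z : ℝ) {u : ℝ → ℝ} (hu : u ∈ normalized spaceX) :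
    Integrable (fun p : ℝ × ℝ => |p.1 - p.2| * u p.1 ^ 2 * u p.2 ^ 2) ∧
    energy z u = (∫ x, weakDeriv u x ^ 2)
      + 1 / 2 * (∫ p : ℝ × ℝ, -|p.1 - p.2| * u p.1 ^ 2 * u p.2 ^ 2)
      + z * ∫ x, |x| * u x ^ 2 := by
  obtain ⟨⟨⟨h2, -⟩, hx⟩, h1⟩ := hu
  have hi : Integrable fun x => u x ^ 2 := h2.integrable_sq
  have hA : Integrable (fun p : ℝ × ℝ => (|p.1| * u p.1 ^ 2) * u p.2 ^ 2) := hx.mul_prod hi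
  have hB : Integrable (fun p : ℝ × ℝ => u p.1 ^ 2 * (|p.2| * u p.2 ^ 2)) := hi.mul_prod hx
  have hD : Integrable (fun p : ℝ × ℝ => |p.1 - p.2| * u p.1 ^ 2 * u p.2 ^ 2) := by
    refine (hA.add hB).mono' ?_ (Eventually.of_forall fun p => ?_)
    · have h : AEStronglyMeasurable (fun p : ℝ × ℝ => |p.1 - p.2| * (u p.1 ^ 2 * u p.2 ^ 2)) :=
        (by fun_prop : Continuous fun p : ℝ × ℝ => |p.1 - p.2|).aestronglyMeasurable.mul
          (hi.mul_prod hi).aestronglyMeasurable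
      simpa only [mul_assoc] using h
    · have h := abs_sub p.1 p.2
      have h' : 0 ≤ u p.1 ^ 2 * u p.2 ^ 2 := by positivity
      rw [Real.norm_of_nonneg (by positivity)]
      simp only [Pi.add_apply]
      nlinarith
  refine ⟨hD, ?_⟩
  have eA : ∫ p : ℝ × ℝ, (|p.1| * u p.1 ^ 2) * u p.2 ^ 2 = ∫ x, |x| * u x ^ 2 := by
    have h := integral_prod_mul (μ := volume) (ν := volume)
      (fun x : ℝ => |x| * u x ^ 2) (fun y : ℝ => u y ^ 2)
    rw [h1, mul_one] at h
    exact h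
  have eB : ∫ p : ℝ × ℝ, u p.1 ^ 2 * (|p.2| * u p.2 ^ 2) = ∫ x, |x| * u x ^ 2 := by
    have h := integral_prod_mul (μ := volume) (ν := volume)
      (fun y : ℝ => u y ^ 2) (fun x : ℝ => |x| * u x ^ 2)
    rw [h1, one_mul] at h
    exact h
  have e : ∀ p : ℝ × ℝ, (z * (|p.1| + |p.2|) - |p.1 - p.2|) * u p.1 ^ 2 * u p.2 ^ 2
      = z * ((|p.1| * u p.1 ^ 2) * u p.2 ^ 2 + u p.1 ^ 2 * (|p.2| * u p.2 ^ 2))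
        - |p.1 - p.2| * u p.1 ^ 2 * u p.2 ^ 2 := fun p => by ring
  unfold energy potentialEnergy
  simp only [e, neg_mul]
  have hS : Integrable (fun p : ℝ × ℝ => z * ((|p.1| * u p.1 ^ 2) * u p.2 ^ 2
      + u p.1 ^ 2 * (|p.2| * u p.2 ^ 2))) := (hA.add hB).const_mul z
  rw [integral_sub hS hD, integral_const_mul, integral_add hA hB, eA, eB, integral_neg]
  ring

end HydrogenLikeAtom

namespace HydrogenLikeAtom

/-! For `z ≥ 1` the energy is the Dirichlet integral plus `(z - 1)` times the first moment plus the
Coulomb energy with kernel `G`, all nonnegative. By layer cake (`coulomb_eq`) the Coulomb term is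
the integral over `r > 0` of the sum of the squared masses of the tails `(r, ∞)` and `(-∞, -r)`. By
convexity it is at least `coulombEven`, which sees only the total mass outside `[-r, r]`, with
equality once the density is made even.

Let `U ≥ 0` be a minimiser and polarize it about `a > 0`, moving the larger values to the left. This
increases neither the Dirichlet integral, nor the moment, nor the mass outside any `[-r, r]`. It may
load the left tail, so the competitor is `symmetrize (polarize a U)`, whose Coulomb energy is
`coulombEven (polarize a U)`. Minimality then gives `coulombEven U ≤ coulomb U ≤ coulombEven
(polarize a U) ≤ coulombEven U`. Hence almost every outer mass is unchanged, so no mass was moved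
towards the origin and `U y ≤ U (2 * a - y)` for `y > a` (`le_reflect_of_isMin`). Varying `a`,
reflecting the line and using continuity yields evenness and monotonicity. Signed minimisers are
treated through `|V|`, with `V` the continuous representative. -/

open scoped Topology ENNReal

/-! ### Locally absolutely continuous functions. -/

/-- Absolute continuity on every bounded interval. -/
def IsLocAC (V : ℝ → ℝ) : Prop := ∀ a b, AbsolutelyContinuousOnInterval V a b

theorem IsLocAC.ae_differentiableAt {V : ℝ → ℝ} (hV : IsLocAC V) :
    ∀ᵐ x, DifferentiableAt ℝ V x := by
  have h : ∀ᵐ x, ∀ n : ℕ, x ∈ uIcc (-(n : ℝ)) n → DifferentiableAt ℝ V x :=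
    ae_all_iff.2 fun n => (hV _ _).ae_differentiableAt
  filter_upwards [h] with x hx
  obtain ⟨n, hn⟩ := exists_nat_ge |x|
  refine hx n ?_
  rw [uIcc_of_le (by linarith [abs_nonneg x])]
  exact ⟨by linarith [neg_abs_le x], by linarith [le_abs_self x]⟩

theorem IsLocAC.continuous {V : ℝ → ℝ} (hV : IsLocAC V) : Continuous V := by
  refine continuous_iff_continuousAt.2 fun x => ?_
  have h := (hV (x - 1) (x + 1)).continuousOn
  rw [uIcc_of_le (by linarith)] at h
  exact h.continuousAt (Icc_mem_nhds (by linarith) (by linarith))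

theorem isLocAC_of_dist_le {V A B : ℝ → ℝ} (hA : IsLocAC A) (hB : IsLocAC B)
    (h : ∀ x y, |V x - V y| ≤ |A x - A y| + |B x - B y|) : IsLocAC V := by
  intro a b
  refine squeeze_zero (fun t => Finset.sum_nonneg fun i _ => dist_nonneg) (fun t => ?_)
    (by simpa using Tendsto.add (hA a b) (hB a b))
  rw [← Finset.sum_add_distrib]
  exact Finset.sum_le_sum fun i _ => h _ _

theorem IsLocAC.abs {V : ℝ → ℝ} (hV : IsLocAC V) : IsLocAC fun x => |V x| :=
  isLocAC_of_dist_le hV hV fun x y =>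
    (abs_abs_sub_abs_le _ _).trans (by linarith [abs_nonneg (V x - V y)])

theorem isLocAC_integral {g : ℝ → ℝ} (hg : ∀ a b, IntervalIntegrable g volume a b) (c : ℝ) :
    IsLocAC fun x => ∫ t in c..x, g t := by
  intro a b
  have hle : min (min a b) c ≤ max (max a b) c := (min_le_right _ _).trans (le_max_right _ _)
  have h := hg (min (min a b) c) (max (max a b) c)
  refine (h.absolutelyContinuousOnInterval_intervalIntegral (c := c) ?_).mono ?_
  · rw [uIcc_of_le hle]; simp
  · rw [uIcc_of_le hle, uIcc]
    exact Icc_subset_Icc (by simp) (by simp)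

theorem IsLocAC.intervalIntegrable {V : ℝ → ℝ} (hV : IsLocAC V) (a b : ℝ) :
    IntervalIntegrable (deriv V) volume a b := (hV a b).intervalIntegrable_deriv

theorem IsLocAC.add {V W : ℝ → ℝ} (hV : IsLocAC V) (hW : IsLocAC W) :
    IsLocAC fun x => V x + W x := fun a b => (hV a b).add (hW a b)

theorem IsLocAC.const_mul {V : ℝ → ℝ} (hV : IsLocAC V) (c : ℝ) :
    IsLocAC fun x => c * V x := fun a b => (hV a b).const_mul c

theorem isLocAC_const (c : ℝ) : IsLocAC fun _ => c := fun a b => by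
  simpa [AbsolutelyContinuousOnInterval] using tendsto_const_nhds

/-- The fundamental theorem of calculus makes the reflected function a primitive of a locally
integrable function. -/
theorem IsLocAC.comp_sub_left {V : ℝ → ℝ} (hV : IsLocAC V) (c : ℝ) :
    IsLocAC fun x => V (c - x) := by
  have h : (fun x => V (c - x)) = fun x => V 0 + -1 * ∫ t in c..x, deriv V (c - t) := by
    funext x
    rw [intervalIntegral.integral_comp_sub_left (fun t => deriv V t), sub_self,
      intervalIntegral.integral_symm, (hV 0 (c - x)).integral_deriv_eq_sub]
    ring
  rw [h]
  refine (isLocAC_const _).add ((isLocAC_integral (fun a b => ?_) c).const_mul _)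
  simpa using (hV.intervalIntegrable (c - a) (c - b)).comp_sub_left c

/-! ### Weak derivatives and continuous representatives. -/

theorem exists_Icc_of_hasCompactSupport {φ : ℝ → ℝ} (h : HasCompactSupport φ) :
    ∃ R > 0, ∀ x, R ≤ |x| → φ x = 0 := by
  obtain ⟨R, hR⟩ := h.isBounded.subset_closedBall (0 : ℝ)
  refine ⟨|R| + 1, by positivity, fun x hx => ?_⟩
  by_contra hne
  have := hR (subset_tsupport φ hne)
  rw [mem_closedBall_zero_iff, Real.norm_eq_abs] at this
  linarith [le_abs_self R]

theorem IsLocAC.isWeakDeriv {V : ℝ → ℝ} (hV : IsLocAC V) (hd : LocallyIntegrable (deriv V)) :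
    IsWeakDeriv V (deriv V) := by
  refine ⟨hV.continuous.locallyIntegrable, hd, fun φ hφ hc => ?_⟩
  obtain ⟨R, hR, hz⟩ := exists_Icc_of_hasCompactSupport hc
  have hφ' : Continuous (deriv φ) := hφ.continuous_deriv (by simp)
  obtain ⟨S, hS, hz'⟩ := exists_Icc_of_hasCompactSupport hc.deriv
  set T := max R S + 1
  have hTR : R < T := by have := le_max_left R S; grind
  have hTS : S < T := by have := le_max_right R S; grind
  have hAC : AbsolutelyContinuousOnInterval φ (-T) T :=
    (hφ.of_le (by simp) : ContDiff ℝ 1 φ).contDiffOn.absolutelyContinuousOnInterval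
  have key := (hV (-T) T).integral_mul_deriv_eq_deriv_mul hAC
  rw [hz T (by rw [abs_of_pos] <;> linarith), hz (-T) (by rw [abs_neg, abs_of_pos] <;> linarith)]
    at key
  have e1 : ∫ x, V x * deriv φ x = ∫ x in (-T)..T, V x * deriv φ x := by
    refine (intervalIntegral.integral_eq_integral_of_support_subset fun x hx => ?_).symm
    by_contra hn
    refine hx ?_
    simp only
    rw [hz' x, mul_zero]
    simp only [mem_Ioc, not_and_or, not_lt, not_le] at hn
    rcases hn with h | h
    · rw [abs_of_neg] <;> linarith
    · rw [abs_of_pos] <;> linarith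
  have e2 : ∫ x, deriv V x * φ x = ∫ x in (-T)..T, deriv V x * φ x := by
    refine (intervalIntegral.integral_eq_integral_of_support_subset fun x hx => ?_).symm
    by_contra hn
    refine hx ?_
    simp only
    rw [hz x, mul_zero]
    simp only [mem_Ioc, not_and_or, not_lt, not_le] at hn
    rcases hn with h | h
    · rw [abs_of_neg] <;> linarith
    · rw [abs_of_pos] <;> linarith
  rw [e1, e2, key]; ring

/-- The lemma of du Bois-Reymond. -/
theorem exists_ae_eq_const_of_integral_mul_deriv_eq_zero {h : ℝ → ℝ} (hh : LocallyIntegrable h)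
    (H : ∀ φ : ℝ → ℝ, ContDiff ℝ ∞ φ → HasCompactSupport φ → ∫ x, h x * deriv φ x = 0) :
    ∃ c, h =ᵐ[volume] fun _ => c := by
  let b : ContDiffBump (0 : ℝ) := default
  set β := b.normed volume
  have hβ : ContDiff ℝ ∞ β := b.contDiff_normed
  have hβc : HasCompactSupport β := b.hasCompactSupport_normed
  have hβ1 : ∫ x, β x = 1 := b.integral_normed
  refine ⟨∫ x, β x * h x, ae_eq_of_integral_contDiff_smul_eq hh (locallyIntegrable_const _)
    fun ψ hψ hψc => ?_⟩
  set I := ∫ x, ψ x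
  -- Removing the mean of `ψ` makes the primitive of `k` compactly supported, hence an admissible
  -- test function.
  set k : ℝ → ℝ := fun x => ψ x - I * β x
  have hk : ContDiff ℝ ∞ k := hψ.sub (contDiff_const.mul hβ)
  have hkc : HasCompactSupport k := hψc.sub hβc.mul_left
  have hψi : Integrable ψ := hψ.continuous.integrable_of_hasCompactSupport hψc
  have hβi : Integrable β := hβ.continuous.integrable_of_hasCompactSupport hβc
  have hk0 : ∫ x, k x = 0 := by
    simp only [k]
    rw [integral_sub hψi (hβi.const_mul _), integral_const_mul, hβ1, mul_one, sub_self]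
  obtain ⟨R, hR, hz⟩ := exists_Icc_of_hasCompactSupport hkc
  set φ : ℝ → ℝ := fun x => ∫ t in (-R)..x, k t
  have hder : ∀ x, HasDerivAt φ (k x) x := fun x =>
    intervalIntegral.integral_hasDerivAt_right (hk.continuous.intervalIntegrable _ _)
      (hk.continuous.stronglyMeasurableAtFilter _ _) hk.continuous.continuousAt
  have hφd : deriv φ = k := funext fun x => (hder x).deriv
  have hφ : ContDiff ℝ ∞ φ :=
    contDiff_infty_iff_deriv.2 ⟨fun x => (hder x).differentiableAt, hφd ▸ hk⟩
  have hφc : HasCompactSupport φ := by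
    refine HasCompactSupport.of_support_subset_isCompact (isCompact_Icc (a := -R) (b := R))
      fun x hx => ?_
    by_contra hn
    refine hx ?_
    simp only [mem_Icc, not_and_or, not_le] at hn
    rcases hn with h1 | h1
    · refine intervalIntegral.integral_zero_ae (Eventually.of_forall fun t ht => hz t ?_)
      rw [uIoc_of_ge h1.le] at ht
      rw [abs_of_nonpos] <;> linarith [ht.2]
    · change ∫ t in (-R)..x, k t = 0
      rw [intervalIntegral.integral_eq_integral_of_support_subset, hk0]
      intro t ht
      by_contra hn
      refine ht (hz t ?_)
      simp only [mem_Ioc, not_and_or, not_lt, not_le] at hn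
      rcases hn with h | h
      · rw [abs_of_nonpos] <;> linarith
      · rw [abs_of_pos] <;> linarith
  have key := H φ hφ hφc
  rw [hφd] at key
  have i1 : Integrable fun x => ψ x * h x :=
    hh.integrable_smul_left_of_hasCompactSupport hψ.continuous hψc
  have i2 : Integrable fun x => β x * h x :=
    hh.integrable_smul_left_of_hasCompactSupport hβ.continuous hβc
  have e : ∀ x, h x * k x = ψ x * h x - I * (β x * h x) := fun x => by simp only [k]; ring
  simp only [e] at key
  rw [integral_sub i1 (i2.const_mul _), integral_const_mul] at key
  simp only [smul_eq_mul]
  rw [integral_mul_const]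
  linarith

theorem IsWeakDeriv.ae_unique {u v g k : ℝ → ℝ} (hg : IsWeakDeriv u g) (hk : IsWeakDeriv v k)
    (huv : u =ᵐ[volume] v) : g =ᵐ[volume] k := by
  refine ae_eq_of_integral_contDiff_smul_eq hg.2.1 hk.2.1 fun φ hφ hc => ?_
  have h1 := hg.2.2 φ hφ hc
  have h2 := hk.2.2 φ hφ hc
  have h3 : ∫ x, u x * deriv φ x = ∫ x, v x * deriv φ x :=
    integral_congr_ae (by filter_upwards [huv] with x hx; rw [hx])
  simp only [smul_eq_mul, mul_comm (φ _)]
  linarith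

theorem weakDeriv_spec {u : ℝ → ℝ} (hu : u ∈ H1) :
    MemLp (weakDeriv u) 2 ∧ IsWeakDeriv u (weakDeriv u) := by
  have h := hu.2
  rw [weakDeriv, dif_pos h]
  exact h.choose_spec

theorem _root_.MeasureTheory.MemLp.locallyIntegrable_two {g : ℝ → ℝ} (hg : MemLp g 2) :
    LocallyIntegrable g := hg.locallyIntegrable (by norm_num)

/-- Every `H¹` function has a locally absolutely continuous representative. -/
theorem exists_isLocAC_ae_eq {u : ℝ → ℝ} (hu : u ∈ H1) :
    ∃ V, IsLocAC V ∧ u =ᵐ[volume] V ∧ deriv V =ᵐ[volume] weakDeriv u := by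
  obtain ⟨hg, hw⟩ := weakDeriv_spec hu
  set g := weakDeriv u
  have hgi : ∀ a b, IntervalIntegrable g volume a b := fun a b =>
    (hw.2.1.integrableOn_isCompact isCompact_uIcc).intervalIntegrable
  -- `u` and the primitive `V₀` share a weak derivative, so they differ by a constant.
  set V₀ : ℝ → ℝ := fun x => ∫ t in (0 : ℝ)..x, g t
  have hV₀ : IsLocAC V₀ := isLocAC_integral hgi 0
  have hd : deriv V₀ =ᵐ[volume] g := by
    filter_upwards [LocallyIntegrable.ae_hasDerivAt_integral hw.2.1] with x hx using (hx 0).deriv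
  have hw₀ := hV₀.isWeakDeriv (hw.2.1.congr hd.symm)
  obtain ⟨c, hc⟩ := exists_ae_eq_const_of_integral_mul_deriv_eq_zero (hw.1.sub hw₀.1)
    fun φ hφ hφc => by
      have hcont : Continuous (deriv φ) := hφ.continuous_deriv (by simp)
      have i1 : Integrable fun x => u x * deriv φ x := by
        simpa [mul_comm] using hw.1.integrable_smul_left_of_hasCompactSupport hcont hφc.deriv
      have i2 : Integrable fun x => V₀ x * deriv φ x := by
        simpa [mul_comm] using hw₀.1.integrable_smul_left_of_hasCompactSupport hcont hφc.deriv
      have e3 : ∫ x, deriv V₀ x * φ x = ∫ x, g x * φ x :=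
        integral_congr_ae (by filter_upwards [hd] with x hx; rw [hx])
      simp only [Pi.sub_apply, sub_mul]
      rw [integral_sub i1 i2, hw.2.2 φ hφ hφc, hw₀.2.2 φ hφ hφc, e3, sub_self]
  refine ⟨fun x => V₀ x + c, hV₀.add (isLocAC_const c), ?_, ?_⟩
  · filter_upwards [hc] with x hx
    simp only [Pi.sub_apply] at hx
    linarith
  · refine EventuallyEq.trans (Eventually.of_forall fun x => ?_) hd
    simp

theorem IsLocAC.mem_H1 {V : ℝ → ℝ} (hV : IsLocAC V) (h2 : MemLp V 2) (hd : MemLp (deriv V) 2) :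
    V ∈ H1 ∧ weakDeriv V =ᵐ[volume] deriv V := by
  have hw := hV.isWeakDeriv hd.locallyIntegrable_two
  have hH : V ∈ H1 := ⟨h2, _, hd, hw⟩
  exact ⟨hH, (weakDeriv_spec hH).2.ae_unique hw EventuallyEq.rfl⟩

/-! ### Pointwise derivative inequalities. -/

/-- At a zero of `s` the function `A` has a local minimum, so its derivative vanishes; elsewhere
differentiate `A² = s²`. -/
theorem sq_deriv_abs_le {s A : ℝ → ℝ} {x : ℝ} (hs : DifferentiableAt ℝ s x)
    (hA : DifferentiableAt ℝ A x) (h : ∀ᶠ y in 𝓝 x, A y = |s y|) :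
    deriv A x ^ 2 ≤ deriv s x ^ 2 := by
  have hx := h.self_of_nhds
  by_cases h0 : s x = 0
  · have hmin : IsLocalMin A x := by
      filter_upwards [h] with y hy
      rw [hx, hy, h0, abs_zero]; exact abs_nonneg _
    rw [hmin.deriv_eq_zero, zero_pow two_ne_zero]
    positivity
  · have e : (fun y => A y ^ 2) =ᶠ[𝓝 x] fun y => s y ^ 2 := by
      filter_upwards [h] with y hy
      rw [hy, sq_abs]
    have e1 := e.deriv_eq
    rw [(hA.hasDerivAt.fun_pow 2).deriv, (hs.hasDerivAt.fun_pow 2).deriv] at e1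
    have e2 : A x ^ 2 = s x ^ 2 := by rw [hx, sq_abs]
    have e3 : s x ^ 2 * deriv A x ^ 2 = s x ^ 2 * deriv s x ^ 2 := by
      have : A x * deriv A x = s x * deriv s x := by simp at e1; linarith
      calc s x ^ 2 * deriv A x ^ 2 = (A x * deriv A x) ^ 2 := by rw [← e2]; ring
        _ = _ := by rw [this]; ring
    exact (mul_left_cancel₀ (pow_ne_zero 2 h0) e3).le

/-- Parallelogram identity applied to `m + n = f + g` and `m - n = |f - g|`. -/
theorem sq_deriv_add_sq_deriv_le {f g m n : ℝ → ℝ} {x : ℝ} (hf : DifferentiableAt ℝ f x)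
    (hg : DifferentiableAt ℝ g x) (hm : DifferentiableAt ℝ m x) (hn : DifferentiableAt ℝ n x)
    (h1 : ∀ᶠ y in 𝓝 x, m y = max (f y) (g y)) (h2 : ∀ᶠ y in 𝓝 x, n y = min (f y) (g y)) :
    deriv m x ^ 2 + deriv n x ^ 2 ≤ deriv f x ^ 2 + deriv g x ^ 2 := by
  have e : (fun y => m y + n y) =ᶠ[𝓝 x] fun y => f y + g y := by
    filter_upwards [h1, h2] with y hy1 hy2
    rw [hy1, hy2, max_add_min]
  have e1 := e.deriv_eq
  rw [deriv_fun_add hm hn, deriv_fun_add hf hg] at e1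
  have e2 := sq_deriv_abs_le (hf.fun_sub hg) (hm.fun_sub hn) (by
    filter_upwards [h1, h2] with y hy1 hy2
    rw [hy1, hy2, max_sub_min_eq_abs, abs_sub_comm])
  rw [deriv_fun_sub hm hn, deriv_fun_sub hf hg] at e2
  nlinarith [congrArg (· ^ 2) e1]

/-- Off its zeros, differentiate the square of the root and apply Cauchy–Schwarz to `V V' + W W'`; a
zero is a minimum. -/
theorem sq_deriv_sqrt_le {V W : ℝ → ℝ} {x : ℝ} (hV : DifferentiableAt ℝ V x)
    (hW : DifferentiableAt ℝ W x)
    (hS : DifferentiableAt ℝ (fun y => √((V y ^ 2 + W y ^ 2) / 2)) x) :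
    deriv (fun y => √((V y ^ 2 + W y ^ 2) / 2)) x ^ 2 ≤ (deriv V x ^ 2 + deriv W x ^ 2) / 2 := by
  set S : ℝ → ℝ := fun y => √((V y ^ 2 + W y ^ 2) / 2)
  have hsq : ∀ y, S y ^ 2 = (V y ^ 2 + W y ^ 2) / 2 := fun y => Real.sq_sqrt (by positivity)
  by_cases h0 : S x = 0
  · have hmin : IsLocalMin S x := by
      refine Eventually.of_forall fun y => ?_
      rw [h0]; exact Real.sqrt_nonneg _
    rw [hmin.deriv_eq_zero, zero_pow two_ne_zero]
    positivity
  · have e := ((hS.hasDerivAt.fun_pow 2).congr_of_eventuallyEq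
      (Eventually.of_forall fun y => (hsq y).symm)).unique
      (((hV.hasDerivAt.fun_pow 2).fun_add (hW.hasDerivAt.fun_pow 2)).div_const 2)
    have e' : S x * deriv S x = (V x * deriv V x + W x * deriv W x) / 2 := by
      simp at e; linarith
    have e2 : S x ^ 2 * deriv S x ^ 2 ≤ S x ^ 2 * ((deriv V x ^ 2 + deriv W x ^ 2) / 2) := by
      rw [← mul_pow, e', hsq]
      nlinarith [sq_nonneg (V x * deriv W x - W x * deriv V x)]
    exact le_of_mul_le_mul_left e2 (by positivity)

/-! ### The Dirichlet integral under modulus, symmetrization and polarization. -/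

/-- The Dirichlet integral `∫ (V')²`. -/
noncomputable def dirichlet (V : ℝ → ℝ) : ℝ≥0∞ := ∫⁻ x, ENNReal.ofReal (deriv V x ^ 2)

theorem dirichlet_abs_le {V : ℝ → ℝ} (hV : IsLocAC V) :
    dirichlet (fun x => |V x|) ≤ dirichlet V := by
  refine lintegral_mono_ae ?_
  filter_upwards [hV.ae_differentiableAt, hV.abs.ae_differentiableAt] with x h1 h2
  exact ENNReal.ofReal_le_ofReal (sq_deriv_abs_le h1 h2 (Eventually.of_forall fun _ => rfl))

theorem lintegral_eq_lintegral_Ioi_add_reflect {f : ℝ → ℝ≥0∞} (hf : Measurable f) (a : ℝ) :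
    ∫⁻ x, f x = ∫⁻ x in Ioi a, (f x + f (2 * a - x)) := by
  rw [lintegral_add_left hf, ← lintegral_add_compl f (measurableSet_Ioi (a := a)), compl_Ioi,
    ← restrict_Iio_eq_restrict_Iic]
  congr 1
  rw [← lintegral_indicator measurableSet_Iio, ← lintegral_indicator measurableSet_Ioi,
    ← lintegral_sub_left_eq_self _ (2 * a)]
  refine lintegral_congr fun x => ?_
  by_cases hx : a < x
  · rw [indicator_of_mem (by simp; linarith), indicator_of_mem (by simpa)]
  · rw [indicator_of_notMem (by simp; linarith), indicator_of_notMem (by simpa using hx)]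

theorem lintegral_comp_neg (f : ℝ → ℝ≥0∞) : ∫⁻ x, f (-x) = ∫⁻ x, f x := by
  simpa using lintegral_sub_left_eq_self f 0

/-- The even function whose square is the even part of `V²`. -/
noncomputable def symmetrize (V : ℝ → ℝ) (x : ℝ) : ℝ := √((V x ^ 2 + V (-x) ^ 2) / 2)

theorem symmetrize_sq (V : ℝ → ℝ) (x : ℝ) :
    symmetrize V x ^ 2 = (V x ^ 2 + V (-x) ^ 2) / 2 := Real.sq_sqrt (by positivity)

/-- A Lipschitz bound for the quadratic mean, from which `symmetrize` inherits absolute continuity.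
-/
theorem sqrt_half_sum_sq_le (a b c d : ℝ) :
    √((a ^ 2 + b ^ 2) / 2) ≤ √((c ^ 2 + d ^ 2) / 2) + (|a - c| + |b - d|) := by
  set s := √((c ^ 2 + d ^ 2) / 2)
  have hs0 : 0 ≤ s := Real.sqrt_nonneg _
  have hs : s ^ 2 = (c ^ 2 + d ^ 2) / 2 := Real.sq_sqrt (by positivity)
  have hc : |c| ≤ 2 * s := abs_le_of_sq_le_sq (by nlinarith [sq_nonneg d]) (by positivity)
  have hd : |d| ≤ 2 * s := abs_le_of_sq_le_sq (by nlinarith [sq_nonneg c]) (by positivity)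
  have p := abs_nonneg (a - c)
  have q := abs_nonneg (b - d)
  refine Real.sqrt_le_iff.2 ⟨by positivity, ?_⟩
  have h1 : c * (a - c) ≤ 2 * s * |a - c| := (le_abs_self _).trans (by rw [abs_mul]; gcongr)
  have h2 : d * (b - d) ≤ 2 * s * |b - d| := (le_abs_self _).trans (by rw [abs_mul]; gcongr)
  nlinarith [sq_abs (a - c), sq_abs (b - d), mul_nonneg p q]

theorem IsLocAC.symmetrize {V : ℝ → ℝ} (hV : IsLocAC V) : IsLocAC (symmetrize V) := by
  refine isLocAC_of_dist_le hV (hV.comp_sub_left 0) fun x y => ?_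
  simp only [zero_sub]
  rw [abs_sub_le_iff]
  constructor
  · have := sqrt_half_sum_sq_le (V x) (V (-x)) (V y) (V (-y))
    simp only [HydrogenLikeAtom.symmetrize]; linarith
  · have := sqrt_half_sum_sq_le (V y) (V (-y)) (V x) (V (-x))
    rw [abs_sub_comm (V x), abs_sub_comm (V (-x))]
    simp only [HydrogenLikeAtom.symmetrize]; linarith

/-- Averaging a density over `x ↦ -x` does not change its integral against an even weight. -/
theorem lintegral_average_neg {f : ℝ → ℝ≥0∞} (hf : Measurable f) :
    ∫⁻ x, (f x + f (-x)) / 2 = ∫⁻ x, f x := by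
  simp_rw [ENNReal.div_eq_inv_mul]
  rw [lintegral_const_mul _ (by fun_prop), lintegral_add_left hf,
    lintegral_comp_neg, ← two_mul, ← mul_assoc, ENNReal.inv_mul_cancel (by simp) (by simp), one_mul]

theorem ofReal_half_add {a b : ℝ} (ha : 0 ≤ a) (hb : 0 ≤ b) :
    ENNReal.ofReal ((a + b) / 2) = (ENNReal.ofReal a + ENNReal.ofReal b) / 2 := by
  rw [ENNReal.ofReal_div_of_pos (by norm_num), ENNReal.ofReal_add ha hb]; simp

theorem dirichlet_symmetrize_le {V : ℝ → ℝ} (hV : IsLocAC V) :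
    dirichlet (symmetrize V) ≤ dirichlet V := by
  have hW := hV.comp_sub_left 0
  simp only [zero_sub] at hW
  unfold dirichlet
  rw [← lintegral_average_neg ((measurable_deriv V).pow_const 2).ennreal_ofReal]
  refine lintegral_mono_ae ?_
  filter_upwards [hV.ae_differentiableAt, hW.ae_differentiableAt,
    hV.symmetrize.ae_differentiableAt] with x h1 h2 h3
  rw [← ofReal_half_add (by positivity) (by positivity)]
  refine ENNReal.ofReal_le_ofReal ((sq_deriv_sqrt_le h1 h2 h3).trans (le_of_eq ?_))
  rw [deriv_comp_neg, neg_sq]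

/-- The polarization (two-point rearrangement) of `U` with respect to the point `a`, in which
the larger values are put to the left of `a`. -/
noncomputable def polarize (a : ℝ) (U : ℝ → ℝ) (x : ℝ) : ℝ :=
  if x ≤ a then max (U x) (U (2 * a - x)) else min (U x) (U (2 * a - x))

theorem polarize_of_lt {a : ℝ} (U : ℝ → ℝ) {x : ℝ} (h : a < x) :
    polarize a U x = min (U x) (U (2 * a - x)) := if_neg h.not_ge

theorem polarize_reflect_of_lt {a : ℝ} (U : ℝ → ℝ) {x : ℝ} (h : a < x) :
    polarize a U (2 * a - x) = max (U x) (U (2 * a - x)) := by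
  rw [polarize, if_pos (by linarith), sub_sub_cancel, max_comm]

/-- With `R` the reflection of `U`, the polarization is half of `U + R ± |U - R|`, with plus on the
left of `a` and minus on the right. Since `|U - R|` vanishes at `a`, the signed term is the
primitive from `a` of a derivative whose sign flips at `a`. -/
theorem IsLocAC.polarize {U : ℝ → ℝ} (hU : IsLocAC U) (a : ℝ) : IsLocAC (polarize a U) := by
  set R : ℝ → ℝ := fun x => U (2 * a - x)
  have hR : IsLocAC R := hU.comp_sub_left _
  set A : ℝ → ℝ := fun x => |U x + -1 * R x|
  have hA : IsLocAC A := (hU.add (hR.const_mul (-1))).abs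
  have hAa : A a = 0 := by simp only [A, R]; ring_nf; simp
  set h : ℝ → ℝ := fun t => if t ≤ a then deriv A t else -deriv A t
  have hh : ∀ p q, IntervalIntegrable h volume p q := fun p q => by
    refine (hA.intervalIntegrable p q).mono_fun ?_ (Eventually.of_forall fun t => ?_)
    · exact (Measurable.ite measurableSet_Iic (measurable_deriv A)
        (measurable_deriv A).neg).aestronglyMeasurable
    · simp only [h]; split_ifs <;> simp
  have e : HydrogenLikeAtom.polarize a U
      = fun x => (1 / 2) * (U x + R x) + (1 / 2) * ∫ t in a..x, h t := by
    funext x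
    have hAx : A x = |U x - R x| := by simp only [A]; ring_nf
    have hmm := max_sub_min_eq_abs (U x) (R x)
    have hpm := max_add_min (U x) (R x)
    rw [abs_sub_comm] at hmm
    by_cases hx : x ≤ a
    · have : ∫ t in a..x, h t = ∫ t in a..x, deriv A t := by
        refine intervalIntegral.integral_congr fun t ht => ?_
        rw [uIcc_of_ge hx] at ht
        exact if_pos ht.2
      rw [this, (hA a x).integral_deriv_eq_sub, hAa, hAx, HydrogenLikeAtom.polarize, if_pos hx]
      change max (U x) (R x) = _
      linarith
    · have : ∫ t in a..x, h t = ∫ t in a..x, -deriv A t := by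
        refine intervalIntegral.integral_congr_ae (Eventually.of_forall fun t ht => ?_)
        rw [uIoc_of_le (not_le.1 hx).le] at ht
        exact if_neg ht.1.not_ge
      rw [this, intervalIntegral.integral_neg, (hA a x).integral_deriv_eq_sub, hAa, hAx,
        HydrogenLikeAtom.polarize, if_neg hx]
      change min (U x) (R x) = _
      linarith
  rw [e]
  exact ((hU.add hR).const_mul _).add ((isLocAC_integral hh a).const_mul _)

theorem dirichlet_polarize_le {U : ℝ → ℝ} (hU : IsLocAC U) (a : ℝ) :
    dirichlet (polarize a U) ≤ dirichlet U := by
  have hP := hU.polarize a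
  unfold dirichlet
  rw [lintegral_eq_lintegral_Ioi_add_reflect ((measurable_deriv _).pow_const 2).ennreal_ofReal a,
    lintegral_eq_lintegral_Ioi_add_reflect ((measurable_deriv _).pow_const 2).ennreal_ofReal a]
  refine setLIntegral_mono_ae' measurableSet_Ioi ?_
  filter_upwards [hU.ae_differentiableAt, (hU.comp_sub_left (2 * a)).ae_differentiableAt,
    hP.ae_differentiableAt, (hP.comp_sub_left (2 * a)).ae_differentiableAt] with x h1 h2 h3 h4 hx
  rw [← ENNReal.ofReal_add (by positivity) (by positivity),
    ← ENNReal.ofReal_add (by positivity) (by positivity)]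
  have key := sq_deriv_add_sq_deriv_le h1 h2 h4 h3
    ((eventually_gt_nhds hx).mono fun y hy => polarize_reflect_of_lt U hy)
    ((eventually_gt_nhds hx).mono fun y hy => polarize_of_lt U hy)
  rw [deriv_comp_const_sub, deriv_comp_const_sub, neg_sq, neg_sq] at key
  exact ENNReal.ofReal_le_ofReal (by linarith)

/-! ### Tail masses and the layer-cake form of the Coulomb energy. -/

/-- The particle density `V²`. -/
noncomputable def density (V : ℝ → ℝ) (x : ℝ) : ℝ≥0∞ := ENNReal.ofReal (V x ^ 2)

theorem measurable_density {V : ℝ → ℝ} (hV : Measurable V) : Measurable (density V) :=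
  (hV.pow_const 2).ennreal_ofReal

theorem measurable_mul_density {V : ℝ → ℝ} (hV : Measurable V) {φ : ℝ → ℝ≥0∞}
    (hφ : Measurable φ) : Measurable fun x => φ x * density V x :=
  hφ.mul (measurable_density hV)

/-- The mass of `V²` outside `[-r, r]`. -/
noncomputable def massOut (V : ℝ → ℝ) (r : ℝ) : ℝ≥0∞ := ∫⁻ x in {x | r < |x|}, density V x

/-- The Coulomb energy with kernel `G`. -/
noncomputable def coulomb (V : ℝ → ℝ) : ℝ≥0∞ :=
  ∫⁻ p : ℝ × ℝ, ENNReal.ofReal (G p.1 p.2 * V p.1 ^ 2 * V p.2 ^ 2)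

/-- The Coulomb energy of the even part of the density. -/
noncomputable def coulombEven (V : ℝ → ℝ) : ℝ≥0∞ := ∫⁻ r in Ioi 0, massOut V r ^ 2 / 2

theorem setLIntegral_Ioi_indicator_Iio (m : ℝ) (c : ℝ≥0∞) :
    ∫⁻ r in Ioi (0 : ℝ), (Iio m).indicator (fun _ => c) r = ENNReal.ofReal m * c := by
  rw [lintegral_indicator_const measurableSet_Iio, Measure.restrict_apply measurableSet_Iio,
    Iio_inter_Ioi, Real.volume_Ioo, sub_zero, mul_comm]

theorem ofReal_G (x y : ℝ) :
    ENNReal.ofReal (G x y) = ENNReal.ofReal (min x y) + ENNReal.ofReal (min (-x) (-y)) := by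
  have h : G x y = max (min x y) 0 + max (min (-x) (-y)) 0 := by
    rw [G_eq]
    split_ifs with h
    · rcases mul_pos_iff.mp h with ⟨hx, hy⟩ | ⟨hx, hy⟩ <;> grind
    · have hxy : (0 ≤ x ∧ y ≤ 0) ∨ (x ≤ 0 ∧ 0 ≤ y) := mul_nonpos_iff.mp (not_lt.mp h)
      grind
  rw [h, ENNReal.ofReal_add (le_max_right _ _) (le_max_right _ _)]
  simp [ENNReal.ofReal_max]

theorem G_nonneg (x y : ℝ) : 0 ≤ G x y := by
  have := abs_sub x y
  unfold G; linarith

/-- `G x y` is the length of the set of `r > 0` for which `x` and `y` lie beyond `r` on the same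
side. This separates the variables. -/
theorem ofReal_G_mul_density (V : ℝ → ℝ) (x y : ℝ) :
    ENNReal.ofReal (G x y * V x ^ 2 * V y ^ 2) = ∫⁻ r in Ioi (0 : ℝ),
      ((Ioi r).indicator (density V) x * (Ioi r).indicator (density V) y
        + (Iio (-r)).indicator (density V) x * (Iio (-r)).indicator (density V) y) := by
  have h1 : ∀ r, (Ioi r).indicator (density V) x * (Ioi r).indicator (density V) y
      = (Iio (min x y)).indicator (fun _ => density V x * density V y) r := fun r => by
    simp only [indicator, mem_Ioi, mem_Iio, lt_min_iff]
    split_ifs <;> simp_all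
  have h2 : ∀ r, (Iio (-r)).indicator (density V) x * (Iio (-r)).indicator (density V) y
      = (Iio (min (-x) (-y))).indicator (fun _ => density V x * density V y) r := fun r => by
    simp only [indicator, mem_Iio, lt_min_iff, lt_neg (a := x), lt_neg (a := y)]
    split_ifs <;> simp_all
  simp_rw [h1, h2]
  rw [lintegral_add_left (measurable_const.indicator measurableSet_Iio),
    setLIntegral_Ioi_indicator_Iio, setLIntegral_Ioi_indicator_Iio, ← add_mul, ← ofReal_G,
    ENNReal.ofReal_mul (mul_nonneg (G_nonneg _ _) (sq_nonneg _)),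
    ENNReal.ofReal_mul (G_nonneg _ _), mul_assoc]
  rfl

theorem coulomb_eq {V : ℝ → ℝ} (hV : Measurable V) :
    coulomb V = ∫⁻ r in Ioi (0 : ℝ),
      ((∫⁻ x in Ioi r, density V x) ^ 2 + (∫⁻ x in Iio (-r), density V x) ^ 2) := by
  have hd := measurable_density hV
  unfold coulomb
  simp_rw [ofReal_G_mul_density]
  have m1 : Measurable fun q : (ℝ × ℝ) × ℝ => (Ioi q.2).indicator (density V) q.1.1 :=
    (hd.comp (measurable_fst.comp measurable_fst)).indicator
      (measurableSet_lt measurable_snd (measurable_fst.comp measurable_fst))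
  have m2 : Measurable fun q : (ℝ × ℝ) × ℝ => (Ioi q.2).indicator (density V) q.1.2 :=
    (hd.comp (measurable_snd.comp measurable_fst)).indicator
      (measurableSet_lt measurable_snd (measurable_snd.comp measurable_fst))
  have m3 : Measurable fun q : (ℝ × ℝ) × ℝ => (Iio (-q.2)).indicator (density V) q.1.1 :=
    (hd.comp (measurable_fst.comp measurable_fst)).indicator
      (measurableSet_lt (measurable_fst.comp measurable_fst) measurable_snd.neg)
  have m4 : Measurable fun q : (ℝ × ℝ) × ℝ => (Iio (-q.2)).indicator (density V) q.1.2 :=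
    (hd.comp (measurable_snd.comp measurable_fst)).indicator
      (measurableSet_lt (measurable_snd.comp measurable_fst) measurable_snd.neg)
  rw [lintegral_lintegral_swap ((m1.mul m2).add (m3.mul m4)).aemeasurable]
  refine lintegral_congr fun r => ?_
  have i1 : Measurable ((Ioi r).indicator (density V)) := hd.indicator measurableSet_Ioi
  have i2 : Measurable ((Iio (-r)).indicator (density V)) := hd.indicator measurableSet_Iio
  have i3 : Measurable fun p : ℝ × ℝ =>
      (Ioi r).indicator (density V) p.1 * (Ioi r).indicator (density V) p.2 := by fun_prop
  rw [lintegral_add_left i3, Measure.volume_eq_prod, lintegral_prod_mul i1.aemeasurable i1.aemeasurable,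
    lintegral_prod_mul i2.aemeasurable i2.aemeasurable, lintegral_indicator measurableSet_Ioi,
    lintegral_indicator measurableSet_Iio, sq, sq]

theorem massOut_eq_add (V : ℝ → ℝ) {r : ℝ} (hr : 0 ≤ r) :
    massOut V r = (∫⁻ x in Ioi r, density V x) + ∫⁻ x in Iio (-r), density V x := by
  rw [← lintegral_union measurableSet_Iio]
  · unfold massOut
    congr 2
    ext x
    simp only [mem_ofPred_eq, mem_union, mem_Ioi, mem_Iio, lt_abs, lt_neg]
  · exact disjoint_left.2 fun x h1 h2 => by simp only [mem_Ioi, mem_Iio] at h1 h2; linarith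

theorem _root_.ENNReal.add_sq_div_two_le (x y : ℝ≥0∞) : (x + y) ^ 2 / 2 ≤ x ^ 2 + y ^ 2 := by
  induction x with
  | top => simp
  | coe x =>
    induction y with
    | top => simp
    | coe y =>
      refine ENNReal.div_le_of_le_mul ?_
      norm_cast
      have := add_sq_le (a := (x : ℝ)) (b := y)
      rw [mul_comm]
      exact_mod_cast this

theorem coulombEven_le_coulomb {V : ℝ → ℝ} (hV : Measurable V) : coulombEven V ≤ coulomb V := by
  rw [coulomb_eq hV]
  refine setLIntegral_mono' measurableSet_Ioi fun r hr => ?_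
  rw [massOut_eq_add V (le_of_lt hr)]
  exact ENNReal.add_sq_div_two_le _ _

/-! ### Symmetrization of the density. -/

theorem density_symmetrize (V : ℝ → ℝ) (x : ℝ) :
    density (symmetrize V) x = (density V x + density V (-x)) / 2 := by
  rw [density, symmetrize_sq, ofReal_half_add (by positivity) (by positivity)]; rfl

theorem lintegral_mul_density_symmetrize {V : ℝ → ℝ} (hV : Measurable V) {φ : ℝ → ℝ≥0∞}
    (hφ : Measurable φ) (he : ∀ x, φ (-x) = φ x) :
    ∫⁻ x, φ x * density (symmetrize V) x = ∫⁻ x, φ x * density V x := by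
  rw [← lintegral_average_neg (measurable_mul_density hV hφ)]
  refine lintegral_congr fun x => ?_
  rw [density_symmetrize, he, ← mul_add, mul_div_assoc]

theorem setLIntegral_Ioi_comp_neg (f : ℝ → ℝ≥0∞) (r : ℝ) :
    ∫⁻ x in Ioi r, f (-x) = ∫⁻ x in Iio (-r), f x := by
  rw [← lintegral_indicator measurableSet_Ioi, ← lintegral_indicator measurableSet_Iio,
    ← lintegral_comp_neg]
  refine lintegral_congr fun x => ?_
  simp only [indicator, mem_Ioi, mem_Iio, lt_neg, neg_neg]

theorem setLIntegral_Iio_comp_neg (f : ℝ → ℝ≥0∞) (r : ℝ) :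
    ∫⁻ x in Iio (-r), f (-x) = ∫⁻ x in Ioi r, f x := by
  rw [← setLIntegral_Ioi_comp_neg (fun x => f (-x))]; simp

theorem _root_.ENNReal.half_sq_add_half_sq (M : ℝ≥0∞) :
    (M / 2) ^ 2 + (M / 2) ^ 2 = M ^ 2 / 2 := by
  conv_rhs => rw [← ENNReal.add_halves M]
  rw [ENNReal.eq_div_iff (by simp) (by simp)]
  ring

/-- Each tail of the even density carries half of `massOut V r`: the equality case of the convexity
bound. -/
theorem coulomb_symmetrize {V : ℝ → ℝ} (hV : Measurable V) (hS : Measurable (symmetrize V)) :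
    coulomb (symmetrize V) = coulombEven V := by
  rw [coulomb_eq hS]
  refine setLIntegral_congr_fun measurableSet_Ioi fun r hr => ?_
  have hd := measurable_density hV
  simp only [density_symmetrize, ENNReal.div_eq_inv_mul]
  rw [lintegral_const_mul _ (by fun_prop), lintegral_const_mul _ (by fun_prop),
    lintegral_add_left hd, lintegral_add_left hd, setLIntegral_Ioi_comp_neg,
    setLIntegral_Iio_comp_neg, add_comm (∫⁻ x in Iio (-r), density V x),
    ← massOut_eq_add V (le_of_lt hr)]
  simp only [← ENNReal.div_eq_inv_mul]
  exact ENNReal.half_sq_add_half_sq _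

/-! ### Polarization of the density. -/

theorem density_polarize_of_lt {a : ℝ} {U : ℝ → ℝ} (hU : ∀ x, 0 ≤ U x) {x : ℝ} (h : a < x) :
    density (polarize a U) x = min (density U x) (density U (2 * a - x)) := by
  unfold density
  rw [polarize_of_lt U h]
  rcases le_total (U x) (U (2 * a - x)) with h' | h'
  · rw [min_eq_left h', min_eq_left]
    exact ENNReal.ofReal_le_ofReal (pow_le_pow_left₀ (hU _) h' 2)
  · rw [min_eq_right h', min_eq_right]
    exact ENNReal.ofReal_le_ofReal (pow_le_pow_left₀ (hU _) h' 2)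

theorem density_polarize_reflect_of_lt {a : ℝ} {U : ℝ → ℝ} (hU : ∀ x, 0 ≤ U x) {x : ℝ}
    (h : a < x) :
    density (polarize a U) (2 * a - x) = max (density U x) (density U (2 * a - x)) := by
  unfold density
  rw [polarize_reflect_of_lt U h]
  rcases le_total (U x) (U (2 * a - x)) with h' | h'
  · rw [max_eq_right h', max_eq_right]
    exact ENNReal.ofReal_le_ofReal (pow_le_pow_left₀ (hU _) h' 2)
  · rw [max_eq_left h', max_eq_left]
    exact ENNReal.ofReal_le_ofReal (pow_le_pow_left₀ (hU _) h' 2)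

/-- The two-point rearrangement inequality behind every monotonicity statement for weighted
integrals under polarization. -/
theorem _root_.ENNReal.mul_min_add_mul_max_le {s t : ℝ≥0∞} (h : t ≤ s) (p q : ℝ≥0∞) :
    s * min p q + t * max p q ≤ s * p + t * q := by
  rcases le_total p q with h' | h'
  · rw [min_eq_left h', max_eq_right h']
  · rw [min_eq_right h', max_eq_left h']
    obtain ⟨d, rfl⟩ := exists_add_of_le h
    obtain ⟨e, rfl⟩ := exists_add_of_le h'
    calc (t + d) * q + t * (q + e) ≤ (t + d) * q + t * (q + e) + d * e := le_self_add
      _ = _ := by ring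

theorem mul_density_polarize_le {a : ℝ} {U : ℝ → ℝ} (hU : ∀ x, 0 ≤ U x) {φ : ℝ → ℝ≥0∞}
    {x : ℝ} (hx : a < x) (h : φ (2 * a - x) ≤ φ x) :
    φ x * density (polarize a U) x + φ (2 * a - x) * density (polarize a U) (2 * a - x)
      ≤ φ x * density U x + φ (2 * a - x) * density U (2 * a - x) := by
  rw [density_polarize_of_lt hU hx, density_polarize_reflect_of_lt hU hx]
  exact ENNReal.mul_min_add_mul_max_le h _ _

/-- Polarization decreases integrals against weights which are larger to the right of `a`. -/
theorem lintegral_mul_density_polarize_le {a : ℝ} {U : ℝ → ℝ} (hU : ∀ x, 0 ≤ U x)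
    (hm : Measurable U) (hp : Measurable (polarize a U)) {φ : ℝ → ℝ≥0∞} (hφ : Measurable φ)
    (h : ∀ x, a < x → φ (2 * a - x) ≤ φ x) :
    ∫⁻ x, φ x * density (polarize a U) x ≤ ∫⁻ x, φ x * density U x := by
  rw [lintegral_eq_lintegral_Ioi_add_reflect (measurable_mul_density hp hφ) a,
    lintegral_eq_lintegral_Ioi_add_reflect (measurable_mul_density hm hφ) a]
  exact setLIntegral_mono' measurableSet_Ioi fun x hx => mul_density_polarize_le hU hx (h x hx)

theorem lintegral_density_polarize {a : ℝ} {U : ℝ → ℝ} (hU : ∀ x, 0 ≤ U x)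
    (hm : Measurable U) (hp : Measurable (polarize a U)) :
    ∫⁻ x, density (polarize a U) x = ∫⁻ x, density U x := by
  rw [lintegral_eq_lintegral_Ioi_add_reflect (measurable_density hp) a,
    lintegral_eq_lintegral_Ioi_add_reflect (measurable_density hm) a]
  refine setLIntegral_congr_fun measurableSet_Ioi fun x hx => ?_
  rw [density_polarize_of_lt hU hx, density_polarize_reflect_of_lt hU hx, min_add_max]

theorem massOut_eq (V : ℝ → ℝ) (r : ℝ) :
    massOut V r = ∫⁻ x, {x : ℝ | r < |x|}.indicator 1 x * density V x := by
  have h : MeasurableSet {x : ℝ | r < |x|} := measurableSet_lt measurable_const measurable_norm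
  rw [massOut, ← lintegral_indicator h]
  exact lintegral_congr fun x => by simp [indicator]

theorem abs_reflect_le {a x : ℝ} (ha : 0 ≤ a) (hx : a < x) : |2 * a - x| ≤ |x| := by
  rw [abs_of_pos (by linarith : 0 < x), abs_le]
  constructor <;> linarith

theorem indicator_reflect_le {a x : ℝ} (ha : 0 ≤ a) (hx : a < x) (r : ℝ) :
    {x : ℝ | r < |x|}.indicator (1 : ℝ → ℝ≥0∞) (2 * a - x) ≤ {x : ℝ | r < |x|}.indicator 1 x := by
  by_cases h : r < |2 * a - x|
  · rw [indicator_of_mem (by exact h), indicator_of_mem (by exact h.trans_le (abs_reflect_le ha hx))]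
    rfl
  · rw [indicator_of_notMem (by exact h)]; exact zero_le

theorem measurable_indicator_abs (r : ℝ) :
    Measurable ({x : ℝ | r < |x|}.indicator (1 : ℝ → ℝ≥0∞)) :=
  measurable_one.indicator (measurableSet_lt measurable_const measurable_norm)

theorem massOut_polarize_le {a : ℝ} (ha : 0 ≤ a) {U : ℝ → ℝ} (hU : ∀ x, 0 ≤ U x)
    (hm : Measurable U) (hp : Measurable (polarize a U)) (r : ℝ) :
    massOut (polarize a U) r ≤ massOut U r := by
  rw [massOut_eq, massOut_eq]
  exact lintegral_mul_density_polarize_le hU hm hp (measurable_indicator_abs r)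
    fun x hx => indicator_reflect_le ha hx r

/-- If polarization does not change the mass outside `[-r, r]`, it does not move mass across. -/
theorem le_reflect_of_massOut_polarize_eq {a : ℝ} (ha : 0 ≤ a) {U : ℝ → ℝ} (hU : ∀ x, 0 ≤ U x)
    (hc : Continuous U) (hp : Measurable (polarize a U)) {r : ℝ} (hfin : massOut U r ≠ ⊤)
    (h : massOut (polarize a U) r = massOut U r) {y : ℝ} (hy : a < y) (hry : r < y)
    (hyr : |2 * a - y| < r) : U y ≤ U (2 * a - y) := by
  by_contra! hlt
  have hm := hc.measurable
  rw [massOut_eq, lintegral_eq_lintegral_Ioi_add_reflect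
    (measurable_mul_density hp (measurable_indicator_abs r)) a] at h
  rw [massOut_eq, lintegral_eq_lintegral_Ioi_add_reflect
    (measurable_mul_density hm (measurable_indicator_abs r)) a] at h hfin
  have mr : Measurable fun x : ℝ => 2 * a - x := by fun_prop
  -- A pointwise inequality with equal finite integrals is an equality almost everywhere.
  have key := ae_eq_of_ae_le_of_lintegral_le
    ((ae_restrict_iff' measurableSet_Ioi).2 (Eventually.of_forall fun x hx =>
      mul_density_polarize_le hU hx (indicator_reflect_le ha hx r))) (h ▸ hfin)
    (((measurable_mul_density hm (measurable_indicator_abs r)).add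
      ((measurable_mul_density hm (measurable_indicator_abs r)).comp mr)).aemeasurable) h.ge
  rw [EventuallyEq, ae_restrict_iff' measurableSet_Ioi] at key
  -- On this set only the outer point is counted and its density strictly drops, so the set is null;
  -- being open and containing `y`, it cannot be.
  have hopen : IsOpen {x : ℝ | a < x ∧ r < x ∧ |2 * a - x| < r ∧ U (2 * a - x) < U x} := by
    refine (isOpen_lt continuous_const continuous_id).and
      ((isOpen_lt continuous_const continuous_id).and ((isOpen_lt ?_ continuous_const).and
        (isOpen_lt ?_ hc))) <;> fun_prop
  have hnull : volume {x : ℝ | a < x ∧ r < x ∧ |2 * a - x| < r ∧ U (2 * a - x) < U x} = 0 := by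
    refine measure_mono_null (fun x hx => ?_) key
    obtain ⟨h1, h2, h3, h4⟩ := hx
    have hx1 : x ∈ {x : ℝ | r < |x|} := h2.trans_le (le_abs_self x)
    have hx2 : 2 * a - x ∉ {x : ℝ | r < |x|} := h3.not_gt
    refine fun hn => ?_
    have hn := hn h1
    have hsq : U (2 * a - x) ^ 2 < U x ^ 2 := pow_lt_pow_left₀ h4 (hU _) two_ne_zero
    have hd : density U (2 * a - x) < density U x :=
      (ENNReal.ofReal_lt_ofReal_iff ((sq_nonneg _).trans_lt hsq)).2 hsq
    rw [indicator_of_mem hx1, indicator_of_notMem hx2, zero_mul, zero_mul, add_zero, add_zero,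
      Pi.one_apply, one_mul, one_mul, density_polarize_of_lt hU h1, min_eq_right hd.le] at hn
    exact hd.ne hn
  exact (hopen.measure_pos volume ⟨y, hy, hry, hyr, hlt⟩).ne' hnull

/-! ### Nonnegative minimisers of the extended energy. -/

/-- The first moment `∫ |x| V²`. -/
noncomputable def moment (V : ℝ → ℝ) : ℝ≥0∞ := ∫⁻ x, ENNReal.ofReal |x| * density V x

/-- The energy as an extended nonnegative number. -/
noncomputable def eenergy (z : ℝ) (V : ℝ → ℝ) : ℝ≥0∞ :=
  dirichlet V + ENNReal.ofReal (z - 1) * moment V + coulomb V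

theorem measurable_ofReal_abs : Measurable fun x : ℝ => ENNReal.ofReal |x| :=
  measurable_norm.ennreal_ofReal

theorem antitone_massOut (V : ℝ → ℝ) : Antitone (massOut V) := fun _ _ h =>
  lintegral_mono_set fun _ hx => lt_of_le_of_lt h hx

theorem eenergy_symmetrize_polarize_le (z : ℝ) {a : ℝ} (ha : 0 ≤ a) {U : ℝ → ℝ} (hU : IsLocAC U)
    (h0 : ∀ x, 0 ≤ U x) :
    eenergy z (symmetrize (polarize a U))
      ≤ dirichlet U + ENNReal.ofReal (z - 1) * moment U + coulombEven (polarize a U) := by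
  have hW := hU.polarize a
  have hWm := hW.continuous.measurable
  unfold eenergy
  rw [coulomb_symmetrize hWm hW.symmetrize.continuous.measurable]
  gcongr
  · exact (dirichlet_symmetrize_le hW).trans (dirichlet_polarize_le hU a)
  · unfold moment
    rw [lintegral_mul_density_symmetrize hWm measurable_ofReal_abs (by simp)]
    exact lintegral_mul_density_polarize_le h0 hU.continuous.measurable hWm measurable_ofReal_abs
      fun x hx => ENNReal.ofReal_le_ofReal (abs_reflect_le ha hx)

theorem lintegral_density_symmetrize {V : ℝ → ℝ} (hV : Measurable V) :
    ∫⁻ x, density (symmetrize V) x = ∫⁻ x, density V x := by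
  simpa using lintegral_mul_density_symmetrize hV (φ := fun _ => 1) measurable_const (by simp)

/-- Comparison with `symmetrize (polarize a U)`: after cancelling the finite Dirichlet and moment
terms, the Coulomb chain closes up and forces equal outer masses at almost every radius. -/
theorem le_reflect_of_isMin {z a : ℝ} (ha : 0 < a) {U : ℝ → ℝ} (hU : IsLocAC U)
    (h0 : ∀ x, 0 ≤ U x) (h1 : ∫⁻ x, density U x = 1) (hE : eenergy z U ≠ ⊤)
    (hmin : ∀ W, IsLocAC W → ∫⁻ x, density W x = 1 → eenergy z U ≤ eenergy z W)
    {y : ℝ} (hy : a < y) : U y ≤ U (2 * a - y) := by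
  have hW := hU.polarize a
  have hWm := hW.continuous.measurable
  have hUm := hU.continuous.measurable
  have hle := (hmin _ hW.symmetrize (by
    rw [lintegral_density_symmetrize hWm, lintegral_density_polarize h0 hUm hWm, h1])).trans
    (eenergy_symmetrize_polarize_le z ha.le hU h0)
  obtain ⟨hE1, hE2⟩ := ENNReal.add_ne_top.1 hE
  have hJ : coulombEven U ≤ coulombEven (polarize a U) :=
    (coulombEven_le_coulomb hUm).trans ((ENNReal.add_le_add_iff_left hE1).1 hle)
  have hJfin : coulombEven U ≠ ⊤ := ne_top_of_le_ne_top hE2 (coulombEven_le_coulomb hUm)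
  have hpt : ∀ r, massOut (polarize a U) r ^ 2 / 2 ≤ massOut U r ^ 2 / 2 := fun r => by
    gcongr
    exact massOut_polarize_le ha.le h0 hUm hWm r
  have hJ' := lintegral_mono (μ := volume.restrict (Ioi (0 : ℝ))) hpt
  have key := ae_eq_of_ae_le_of_lintegral_le (Eventually.of_forall hpt)
    (ne_top_of_le_ne_top hJfin hJ')
    ((((antitone_massOut U).measurable.pow_const 2).div_const 2).aemeasurable) hJ
  rw [EventuallyEq, ae_restrict_iff' measurableSet_Ioi] at key
  have hlt : |2 * a - y| < y := abs_lt.2 ⟨by linarith, by linarith⟩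
  -- Positivity of `a` makes this interval of radii separating `y` from its reflection nonempty, so
  -- it contains a good radius.
  obtain ⟨r, hr, hrk⟩ : ∃ r ∈ Ioo |2 * a - y| y, r ∈ Ioi 0 →
      massOut (polarize a U) r ^ 2 / 2 = massOut U r ^ 2 / 2 := by
    by_contra! hn
    refine (isOpen_Ioo.measure_pos volume (nonempty_Ioo.2 hlt)).ne' (measure_mono_null ?_ key)
    exact fun r hr h => (hn r hr).2 (h (hn r hr).1)
  have hrk := hrk ((abs_nonneg _).trans_lt hr.1)
  have hfin : massOut U r ≠ ⊤ :=
    ne_top_of_le_ne_top ENNReal.one_ne_top (h1 ▸ setLIntegral_le_lintegral _ _)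
  refine le_reflect_of_massOut_polarize_eq ha.le h0 hU.continuous hWm hfin ?_ hy hr.2 hr.1
  simp only [ENNReal.div_eq_inv_mul] at hrk
  exact (ENNReal.pow_right_strictMono two_ne_zero).injective
    ((ENNReal.mul_right_inj (by simp) (by simp)).1 hrk)

theorem density_comp_neg (V : ℝ → ℝ) (x : ℝ) : density (fun x => V (-x)) x = density V (-x) := rfl

theorem eenergy_comp_neg (z : ℝ) {V : ℝ → ℝ} (hV : Measurable V) :
    eenergy z (fun x => V (-x)) = eenergy z V := by
  have hV' : Measurable fun x => V (-x) := by fun_prop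
  unfold eenergy
  refine congrArg₂ _ (congrArg₂ _ ?_ (congrArg _ ?_)) ?_
  · unfold dirichlet
    rw [← lintegral_comp_neg]
    simp only [deriv_comp_neg, neg_neg, neg_sq]
  · unfold moment
    rw [← lintegral_comp_neg]
    simp only [density_comp_neg, neg_neg, abs_neg]
  · rw [coulomb_eq hV, coulomb_eq hV']
    refine lintegral_congr fun r => ?_
    simp only [density_comp_neg]
    rw [setLIntegral_Ioi_comp_neg, setLIntegral_Iio_comp_neg, add_comm]

theorem le_of_abs_lt_of_isMin {z : ℝ} {U : ℝ → ℝ} (hU : IsLocAC U)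
    (h0 : ∀ x, 0 ≤ U x) (h1 : ∫⁻ x, density U x = 1) (hE : eenergy z U ≠ ⊤)
    (hmin : ∀ W, IsLocAC W → ∫⁻ x, density W x = 1 → eenergy z U ≤ eenergy z W)
    {x y : ℝ} (h : |x| < y) : U y ≤ U x := by
  have := abs_lt.1 h
  have := le_reflect_of_isMin (a := (x + y) / 2) (by linarith) hU h0 h1 hE hmin
    (y := y) (by linarith)
  rwa [show 2 * ((x + y) / 2) - y = x by ring] at this

/-- The comparison `U y ≤ U x` for `|x| < y` gives `U x ≤ U (-x)` for `x ≥ 0` as `y` decreases to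
`x`. The reflected minimiser gives the reverse inequality. -/
theorem isSymmNonincreasing_of_isMin {z : ℝ} {U : ℝ → ℝ} (hU : IsLocAC U)
    (h0 : ∀ x, 0 ≤ U x) (h1 : ∫⁻ x, density U x = 1) (hE : eenergy z U ≠ ⊤)
    (hmin : ∀ W, IsLocAC W → ∫⁻ x, density W x = 1 → eenergy z U ≤ eenergy z W) :
    IsSymmNonincreasing U := by
  have hUm := hU.continuous.measurable
  set R : ℝ → ℝ := fun x => U (-x)
  have hR : IsLocAC R := by simpa using hU.comp_sub_left 0
  have eR : eenergy z R = eenergy z U := eenergy_comp_neg z hUm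
  have key : ∀ x y, |x| < y → U y ≤ U x := fun x y =>
    le_of_abs_lt_of_isMin hU h0 h1 hE hmin
  have keyR : ∀ x y, |x| < y → R y ≤ R x := fun x y =>
    le_of_abs_lt_of_isMin hR (fun _ => h0 _) ((lintegral_comp_neg _).trans h1) (eR ▸ hE)
      (eR ▸ hmin)
  have lim : ∀ {F : ℝ → ℝ}, Continuous F → (∀ x y, |x| < y → F y ≤ F x) →
      ∀ x, 0 ≤ x → F x ≤ F (-x) := fun {F} hF hk x hx => by
    refine le_of_tendsto (hF.continuousWithinAt (s := Ioi x) (x := x)) ?_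
    filter_upwards [self_mem_nhdsWithin] with y hy
    exact hk _ _ (by rwa [abs_neg, abs_of_nonneg hx])
  have ev : ∀ x, 0 ≤ x → U (-x) = U x := fun x hx =>
    le_antisymm (by simpa [R] using lim hR.continuous keyR x hx) (lim hU.continuous key x hx)
  refine ⟨fun x => ?_, fun x hx y _ hxy => ?_⟩
  · rcases le_total 0 x with hx | hx
    · exact ev x hx
    · simpa using (ev (-x) (by linarith)).symm
  · rcases hxy.eq_or_lt with rfl | hlt
    · exact le_rfl
    · exact key x y (by rwa [abs_of_nonneg hx])

/-! ### Modulus and constant sign. -/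

theorem eenergy_abs_le (z : ℝ) {V : ℝ → ℝ} (hV : IsLocAC V) :
    eenergy z (fun x => |V x|) ≤ eenergy z V := by
  have h1 : moment (fun x => |V x|) = moment V := by simp [moment, density]
  have h2 : coulomb (fun x => |V x|) = coulomb V := by simp [coulomb]
  unfold eenergy
  rw [h1, h2]
  gcongr
  exact dirichlet_abs_le hV

/-- A continuous function with symmetric nonincreasing absolute value has constant sign. -/
theorem eq_abs_or_eq_neg_abs {V : ℝ → ℝ} (hV : Continuous V)
    (h : IsSymmNonincreasing fun x => |V x|) : (∀ x, V x = |V x|) ∨ ∀ x, V x = -|V x| := by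
  have main : ∀ W : ℝ → ℝ, Continuous W → IsSymmNonincreasing (fun x => |W x|) → 0 ≤ W 0 →
      ∀ x, W x = |W x| := by
    intro W hW hs h0 x
    rw [eq_comm, abs_eq_self]
    by_contra! hx
    -- A sign change produces a zero between `0` and `x`, and monotonicity of `|W|` then forces `W x
    -- = 0`.
    obtain ⟨t, ht, ht0⟩ := intermediate_value_uIcc (hW.continuousOn (s := uIcc 0 x))
      (show (0 : ℝ) ∈ uIcc (W 0) (W x) by rw [uIcc_of_ge (by linarith)]; exact ⟨hx.le, h0⟩)
    have habs : ∀ y, |W (|y|)| = |W y| := fun y => by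
      rcases abs_choice y with e | e <;> rw [e]
      exact hs.1 y
    have htx : |t| ≤ |x| := by
      rw [mem_uIcc] at ht
      rcases ht with ⟨h1, h2⟩ | ⟨h1, h2⟩
      · rwa [abs_of_nonneg h1, abs_of_nonneg (h1.trans h2)]
      · rw [abs_of_nonpos h2, abs_of_nonpos (h1.trans h2)]; linarith
    have := hs.2 (abs_nonneg t) (abs_nonneg x) htx
    simp only [habs, ht0, abs_zero] at this
    exact hx.ne (abs_eq_zero.1 (le_antisymm this (abs_nonneg _)))
  rcases le_total 0 (V 0) with h0 | h0
  · exact Or.inl (main V hV h h0)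
  · refine Or.inr fun x => ?_
    have := main (fun x => -V x) hV.neg (by simpa using h) (by simpa using h0) x
    rw [abs_neg] at this
    linarith

/-! ### From the real energy to the extended energy. -/

theorem G_le_abs (x y : ℝ) : G x y ≤ |x| := by
  have := abs_sub_abs_le_abs_sub y x
  rw [abs_sub_comm] at this
  unfold G; linarith

theorem continuous_G : Continuous fun p : ℝ × ℝ => G p.1 p.2 := by
  unfold G; fun_prop

/-- The kernel equals `(z - 1) * (|x| + |y|) + 2 * G x y`. At `z = 1` the first part vanishes, so no
finite moment is needed. -/
theorem potentialEnergy_sq {z : ℝ} {V : ℝ → ℝ} (hi : Integrable fun x => V x ^ 2)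
    (h1 : ∫ x, V x ^ 2 = 1)
    (hG : Integrable fun p : ℝ × ℝ => G p.1 p.2 * V p.1 ^ 2 * V p.2 ^ 2)
    (hx : z = 1 ∨ Integrable fun x => |x| * V x ^ 2) :
    potentialEnergy z (fun x => V x ^ 2) = (z - 1) * (∫ x, |x| * V x ^ 2)
      + ∫ p : ℝ × ℝ, G p.1 p.2 * V p.1 ^ 2 * V p.2 ^ 2 := by
  unfold potentialEnergy
  rcases hx with rfl | hx
  · have e : ∀ p : ℝ × ℝ, (1 * (|p.1| + |p.2|) - |p.1 - p.2|) * V p.1 ^ 2 * V p.2 ^ 2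
        = 2 * (G p.1 p.2 * V p.1 ^ 2 * V p.2 ^ 2) := fun p => by unfold G; ring
    simp only [e]
    rw [integral_const_mul]; ring
  · have hA : Integrable (fun p : ℝ × ℝ => (|p.1| * V p.1 ^ 2) * V p.2 ^ 2) := hx.mul_prod hi
    have hB : Integrable (fun p : ℝ × ℝ => V p.1 ^ 2 * (|p.2| * V p.2 ^ 2)) := hi.mul_prod hx
    have eA := integral_prod_mul (μ := volume) (ν := volume)
      (fun x : ℝ => |x| * V x ^ 2) (fun y : ℝ => V y ^ 2)
    have eB := integral_prod_mul (μ := volume) (ν := volume)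
      (fun y : ℝ => V y ^ 2) (fun x : ℝ => |x| * V x ^ 2)
    rw [h1, mul_one, ← Measure.volume_eq_prod] at eA
    rw [h1, one_mul, ← Measure.volume_eq_prod] at eB
    have e : ∀ p : ℝ × ℝ, (z * (|p.1| + |p.2|) - |p.1 - p.2|) * V p.1 ^ 2 * V p.2 ^ 2
        = (z - 1) * ((|p.1| * V p.1 ^ 2) * V p.2 ^ 2 + V p.1 ^ 2 * (|p.2| * V p.2 ^ 2))
          + 2 * (G p.1 p.2 * V p.1 ^ 2 * V p.2 ^ 2) := fun p => by unfold G; ring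
    have hS : Integrable (fun p : ℝ × ℝ => (z - 1) * ((|p.1| * V p.1 ^ 2) * V p.2 ^ 2
        + V p.1 ^ 2 * (|p.2| * V p.2 ^ 2))) := (hA.add hB).const_mul _
    simp only [e]
    rw [integral_add hS (hG.const_mul 2), integral_const_mul, integral_const_mul,
      integral_add hA hB, eA, eB]
    ring

/-- Membership in the domain of the minimisation problem. -/
def IsAdmissible (z : ℝ) (u : ℝ → ℝ) : Prop :=
  (1 < z ∧ u ∈ normalized spaceX) ∨ (z = 1 ∧ u ∈ normalized spaceB)

theorem integrable_iff_lintegral_ne_top {α : Type*} [MeasureSpace α] {f : α → ℝ}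
    (hf : AEStronglyMeasurable f) (h0 : ∀ x, 0 ≤ f x) :
    Integrable f ↔ ∫⁻ x, ENNReal.ofReal (f x) ≠ ⊤ :=
  (lintegral_ofReal_ne_top_iff_integrable hf (Eventually.of_forall h0)).symm

theorem integral_eq_toReal_lintegral {α : Type*} [MeasureSpace α] {f : α → ℝ}
    (hf : AEStronglyMeasurable f) (h0 : ∀ x, 0 ≤ f x) :
    ∫ x, f x = (∫⁻ x, ENNReal.ofReal (f x)).toReal :=
  integral_eq_lintegral_of_nonneg_ae (Eventually.of_forall h0) hf

theorem coulomb_integrand_nonneg (V : ℝ → ℝ) (p : ℝ × ℝ) :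
    0 ≤ G p.1 p.2 * V p.1 ^ 2 * V p.2 ^ 2 := by
  have := G_nonneg p.1 p.2
  positivity

theorem continuous_coulomb_integrand {V : ℝ → ℝ} (hV : Continuous V) :
    Continuous fun p : ℝ × ℝ => G p.1 p.2 * V p.1 ^ 2 * V p.2 ^ 2 := by
  have := continuous_G
  fun_prop

theorem moment_eq (V : ℝ → ℝ) : moment V = ∫⁻ x, ENNReal.ofReal (|x| * V x ^ 2) :=
  lintegral_congr fun x => (ENNReal.ofReal_mul (abs_nonneg x)).symm

/-- Both domains become the single condition of finite extended energy. For `z > 1` the positive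
coefficient controls the moment, and conversely `G_le_abs` lets the moment control the Coulomb term;
for `z = 1` the moment term is zero even if the moment is infinite. -/
theorem IsLocAC.isAdmissible_iff {z : ℝ} (hz : 1 ≤ z) {V : ℝ → ℝ} (hV : IsLocAC V) :
    (IsAdmissible z V ↔ ∫⁻ x, density V x = 1 ∧ eenergy z V ≠ ⊤) ∧
      (IsAdmissible z V → energy z V = (eenergy z V).toReal) := by
  have hc := hV.continuous
  have mV : AEStronglyMeasurable fun x => V x ^ 2 := (hc.pow 2).aestronglyMeasurable
  have mX : AEStronglyMeasurable fun x => |x| * V x ^ 2 :=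
    (continuous_abs.mul (hc.pow 2)).aestronglyMeasurable
  have mD : AEStronglyMeasurable fun x => deriv V x ^ 2 :=
    ((measurable_deriv V).pow_const 2).aestronglyMeasurable
  have mG := (continuous_coulomb_integrand hc).aestronglyMeasurable (μ := volume)
  have iV := integrable_iff_lintegral_ne_top mV fun x => sq_nonneg _
  have iX := integrable_iff_lintegral_ne_top mX fun x => by positivity
  have iD := integrable_iff_lintegral_ne_top mD fun x => sq_nonneg _
  have iG := integrable_iff_lintegral_ne_top mG (coulomb_integrand_nonneg V)
  have eV := integral_eq_toReal_lintegral mV fun x => sq_nonneg _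
  have eX := integral_eq_toReal_lintegral mX fun x => by positivity
  have eD := integral_eq_toReal_lintegral mD fun x => sq_nonneg _
  have eG := integral_eq_toReal_lintegral mG (coulomb_integrand_nonneg V)
  have mass : ∫⁻ x, density V x = 1 ↔ ∫ x, V x ^ 2 = 1 := by
    rw [eV]
    exact (ENNReal.toReal_eq_one_iff _).symm
  rw [← moment_eq] at iX eX
  rw [← coulomb] at iG eG
  have hH1 : V ∈ H1 → weakDeriv V =ᵐ[volume] deriv V := fun h => by
    obtain ⟨W, hW, hVW, hd⟩ := exists_isLocAC_ae_eq h
    have : V = W := hc.ae_eq_iff_eq volume hW.continuous |>.1 hVW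
    exact this ▸ hd.symm
  have facts : IsAdmissible z V → V ∈ H1 ∧ ∫ x, V x ^ 2 = 1 ∧
      (Integrable fun p : ℝ × ℝ => G p.1 p.2 * V p.1 ^ 2 * V p.2 ^ 2) ∧
      (z = 1 ∨ Integrable fun x => |x| * V x ^ 2) := by
    rintro (⟨h, ⟨hH, hx⟩, h1⟩ | ⟨h, ⟨hH, hG⟩, h1⟩)
    · refine ⟨hH, h1, (hx.mul_prod hH.1.integrable_sq).mono' mG
        (Eventually.of_forall fun p => ?_), Or.inr hx⟩
      rw [Real.norm_of_nonneg (coulomb_integrand_nonneg V p)]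
      have := G_le_abs p.1 p.2
      gcongr
    · exact ⟨hH, h1, hG, Or.inl h⟩
  have dirF : V ∈ H1 → dirichlet V ≠ ⊤ := fun hH =>
    iD.1 ((weakDeriv_spec hH).1.ae_eq (hH1 hH)).integrable_sq
  refine ⟨⟨fun h => ?_, fun ⟨h1, hE⟩ => ?_⟩, fun h => ?_⟩
  · obtain ⟨hH, h1, hG, hx⟩ := facts h
    refine ⟨mass.2 h1, ENNReal.add_ne_top.2 ⟨ENNReal.add_ne_top.2 ⟨dirF hH, ?_⟩, iG.1 hG⟩⟩
    rcases hx with rfl | hx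
    · simp
    · exact ENNReal.mul_ne_top ENNReal.ofReal_ne_top (iX.1 hx)
  · obtain ⟨hE1, hE3⟩ := ENNReal.add_ne_top.1 hE
    obtain ⟨hE1, hE2⟩ := ENNReal.add_ne_top.1 hE1
    have hL : MemLp V 2 := (memLp_two_iff_integrable_sq hc.aestronglyMeasurable).2
      (iV.2 (by change ∫⁻ x, density V x ≠ ⊤; rw [h1]; simp))
    have hLd : MemLp (deriv V) 2 := (memLp_two_iff_integrable_sq
      (measurable_deriv V).aestronglyMeasurable).2 (iD.2 hE1)
    have hH := (hV.mem_H1 hL hLd).1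
    rcases hz.eq_or_lt with rfl | hz
    · exact Or.inr ⟨rfl, ⟨hH, iG.2 hE3⟩, mass.1 h1⟩
    · refine Or.inl ⟨hz, ⟨hH, iX.2 fun htop => hE2 ?_⟩, mass.1 h1⟩
      rw [htop, ENNReal.mul_top (by simpa using hz)]
  · obtain ⟨hH, h1, hG, hx⟩ := facts h
    have hmul : ENNReal.ofReal (z - 1) * moment V ≠ ⊤ := by
      rcases hx with rfl | hx
      · simp
      · exact ENNReal.mul_ne_top ENNReal.ofReal_ne_top (iX.1 hx)
    unfold energy
    rw [potentialEnergy_sq hH.1.integrable_sq h1 hG hx, eenergy, ENNReal.toReal_add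
      (ENNReal.add_ne_top.2 ⟨dirF hH, hmul⟩) (iG.1 hG), ENNReal.toReal_add (dirF hH) hmul,
      ENNReal.toReal_mul, ENNReal.toReal_ofReal (by linarith), eX, eG]
    have : ∫ x, weakDeriv V x ^ 2 = (dirichlet V).toReal := by
      rw [dirichlet, ← eD]
      exact integral_congr_ae ((hH1 hH).mono fun x hx => by simp only [hx])
    rw [this, add_assoc]

theorem prod_ae_eq {u V : ℝ → ℝ} (h : u =ᵐ[volume] V) :
    ∀ᵐ p : ℝ × ℝ, u p.1 = V p.1 ∧ u p.2 = V p.2 := by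
  filter_upwards [Measure.quasiMeasurePreserving_fst.ae_eq_comp (ν := volume) h,
    Measure.quasiMeasurePreserving_snd.ae_eq_comp (μ := volume) h] with p h1 h2
  exact ⟨h1, h2⟩

theorem H1_congr {u V : ℝ → ℝ} (h : u =ᵐ[volume] V) (hu : u ∈ H1) : V ∈ H1 := by
  obtain ⟨h2, g, hg, hw⟩ := hu
  refine ⟨h2.ae_eq h, g, hg, hw.1.congr h, hw.2.1, fun φ hφ hc => ?_⟩
  rw [← hw.2.2 φ hφ hc]
  exact integral_congr_ae (h.mono fun x hx => by simp only [hx])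

theorem IsAdmissible.congr {z : ℝ} {u V : ℝ → ℝ} (h : u =ᵐ[volume] V) (hu : IsAdmissible z u) :
    IsAdmissible z V := by
  have e1 : ∫ x, V x ^ 2 = ∫ x, u x ^ 2 :=
    integral_congr_ae (h.mono fun x hx => by simp only [hx])
  refine hu.imp (fun ⟨hz, hx, h1⟩ => ⟨hz, ⟨H1_congr h hx.1, hx.2.congr ?_⟩, e1.trans h1⟩)
    fun ⟨hz, hx, h1⟩ => ⟨hz, ⟨H1_congr h hx.1, hx.2.congr ?_⟩, e1.trans h1⟩
  · exact h.mono fun x hx => by simp only [hx]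
  · exact (prod_ae_eq h).mono fun p hp => by simp only [hp.1, hp.2]

/-- `weakDeriv` is a choice that depends on the function itself, so uniqueness of weak derivatives
is needed. -/
theorem energy_congr (z : ℝ) {u V : ℝ → ℝ} (h : u =ᵐ[volume] V) (hu : u ∈ H1) :
    energy z u = energy z V := by
  have hd := (weakDeriv_spec hu).2.ae_unique (weakDeriv_spec (H1_congr h hu)).2 h
  unfold energy potentialEnergy
  congr 1
  · exact integral_congr_ae (hd.mono fun x hx => by simp only [hx])
  · congr 1
    exact integral_congr_ae ((prod_ae_eq h).mono fun p hp => by simp only [hp.1, hp.2])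

theorem IsAdmissible.mem_H1 {z : ℝ} {u : ℝ → ℝ} (hu : IsAdmissible z u) : u ∈ H1 :=
  hu.elim (fun h => h.2.1.1) fun h => h.2.1.1

theorem IsAdmissible.one_le {z : ℝ} {u : ℝ → ℝ} (hu : IsAdmissible z u) : 1 ≤ z :=
  hu.elim (fun h => h.1.le) fun h => h.1.ge

/-- Minimisers of the energy are symmetric nonincreasing up to a global sign. -/
theorem exists_isSymmNonincreasing_of_isMin {z : ℝ} {u : ℝ → ℝ} (hu : IsAdmissible z u)
    (hmin : ∀ w, IsAdmissible z w → energy z u ≤ energy z w) :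
    ∃ v : ℝ → ℝ, Continuous v ∧ (∀ x, 0 ≤ v x) ∧ IsSymmNonincreasing v ∧
      (u =ᵐ[volume] v ∨ u =ᵐ[volume] -v) := by
  have hz := hu.one_le
  obtain ⟨V, hV, huV, -⟩ := exists_isLocAC_ae_eq hu.mem_H1
  have hVa := hu.congr huV
  have eV := (hV.isAdmissible_iff hz).2 hVa
  obtain ⟨hV1, hVE⟩ := (hV.isAdmissible_iff hz).1.1 hVa
  have minV : ∀ W, IsLocAC W → ∫⁻ x, density W x = 1 → eenergy z V ≤ eenergy z W := by
    intro W hW hW1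
    by_cases hWE : eenergy z W = ⊤
    · simp [hWE]
    · have hWa := (hW.isAdmissible_iff hz).1.2 ⟨hW1, hWE⟩
      have := hmin W hWa
      rw [energy_congr z huV hu.mem_H1, eV, (hW.isAdmissible_iff hz).2 hWa] at this
      exact (ENNReal.toReal_le_toReal hVE hWE).1 this
  -- The modulus has the same mass and no larger energy, so it is a nonnegative minimiser.
  have habs := eenergy_abs_le z hV
  have hs : IsSymmNonincreasing fun x => |V x| :=
    isSymmNonincreasing_of_isMin hV.abs (fun _ => abs_nonneg _)
      (by simpa [density] using hV1) (ne_top_of_le_ne_top hVE habs)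
      fun W hW hW1 => habs.trans (minV W hW hW1)
  refine ⟨_, hV.abs.continuous, fun _ => abs_nonneg _, hs, ?_⟩
  refine (eq_abs_or_eq_neg_abs hV.continuous hs).imp (fun h => ?_) fun h => ?_
  · filter_upwards [huV] with x hx using hx.trans (h x)
  · filter_upwards [huV] with x hx using hx.trans (h x)

end HydrogenLikeAtom

theorem mainTheorem5 (z : ℝ) (u : ℝ → ℝ)
    (hu : (1 < z ∧ u ∈ HydrogenLikeAtom.normalized HydrogenLikeAtom.spaceX ∧
            IsMinOn (HydrogenLikeAtom.energy z)
              (HydrogenLikeAtom.normalized HydrogenLikeAtom.spaceX) u) ∨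
          (z = 1 ∧ u ∈ HydrogenLikeAtom.normalized HydrogenLikeAtom.spaceB ∧
            IsMinOn (HydrogenLikeAtom.energy z)
              (HydrogenLikeAtom.normalized HydrogenLikeAtom.spaceB) u)) :
    ∃ v : ℝ → ℝ, Continuous v ∧ (∀ x, 0 ≤ v x) ∧ HydrogenLikeAtom.IsSymmNonincreasing v ∧
      (u =ᵐ[volume] v ∨ u =ᵐ[volume] -v) := by
  rcases hu with ⟨hz, hu, hmin⟩ | ⟨hz, hu, hmin⟩
  · refine HydrogenLikeAtom.exists_isSymmNonincreasing_of_isMin (Or.inl ⟨hz, hu⟩) ?_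
    rintro w (⟨-, hw⟩ | ⟨hz', -⟩)
    · exact hmin hw
    · exact absurd hz' hz.ne'
  · refine HydrogenLikeAtom.exists_isSymmNonincreasing_of_isMin (Or.inr ⟨hz, hu⟩) ?_
    rintro w (⟨hz', -⟩ | ⟨-, hw⟩)
    · exact absurd hz hz'.ne'
    · exact hmin hw
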